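/- Let $k\ge 1$, $f\in\mathbb{Q}^2\setminus\mathbb{Z}^2$ and $r^1,\dots,r^k\in\mathbb{Q}^2\setminus\{0\}$. Let $R_f^k\subseteq\mathbb{R}^k_+$ be the convex hull of all $s\ge 0$ with $f+\sum_{j=1}^k s_j r^j\in\mathbb{Z}^2$. For a convex set $B\subseteq\mathbb{R}^2$ with $f$ in its interior, define $\psi_B:\mathbb{R}^2\to\mathbb{R}_+$ by $\psi_B(r)=1/\lambda$ if $f+\lambda r$ lies on the boundary of $B$ for some $\lambda>0$, and $\psi_B(r)=0$ if there is no such $\lambda$ (in particular $\psi_B(0)=0$). A split is a set $\{x\in\mathbb{R}^2: c\le ax_1+bx_2\le c+1\}$ with $a,b,c\in\mathbb{Z}$ and $a,b$ coprime. The split closure $S_f^k$ is the set of all $s\in\mathbb{R}^k_+$ satisfying $\sum_{j=1}^k\psi_B(r^j)s_j\ge 1$ for every split $B$ with $f$ in its interior. A lattice-free set is a convex set in $\mathbb{R}^2$ with no integral point in its interior. A Type 1 triangle is a triangle that is an inclusion-maximal lattice-free set, has integral vertices, and has exactly one integral point in the relative interior of each edge. Let $\mathcal{F}$ be the family of all functions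 $\psi=\psi_T$, where $T$ is a Type 1 triangle with $f$ in its interior, such that the inequality $\sum_{j=1}^k\psi_T(r^j)s_j\ge1$ defines a facet of $R_f^k$. Put $$\bar S_f = S_f^k\cap\Big\{s\in\mathbb{R}^k:\ \sum_{j=1}^k\psi(r^j)s_j\ge 1\ \text{ for all }\psi\in\mathcal{F}\Big\}.$$ For $\alpha>0$ and a set $Q=\{x: a^i x\ge b_i \text{ for all } i\}$ with all $a^i\ge0$, $b_i\ge 0$, let $\alpha Q=\{x:\alpha\, a^i x\ge b_i\text{ for all } i\}=\{x:\alpha x\in Q\}$. (So $\alpha Q\supseteq Q$ for $\alpha\ge 1$; this is not the pointwise multiple of $Q$ by $\alpha$ but the one by $1/\alpha$.) Then $$\bar S_f\subseteq S_f^k\subseteq 2\bar S_f ,$$ that is, adding all Type 1 triangle facets improves the split closure by at most a factor of $2$. -/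

import Mathlib

namespace LatticeCuts

/-- A point of the plane with integer coordinates. -/
def IsLatticePoint (x : Fin 2 → ℝ) : Prop := ∀ i, ∃ z : ℤ, x i = z

/-- A point of the plane with rational coordinates. -/
def IsRationalPoint (x : Fin 2 → ℝ) : Prop := ∀ i, ∃ q : ℚ, x i = q

/-- A convex set with no integral point in its interior. -/
def IsLatticeFree (B : Set (Fin 2 → ℝ)) : Prop :=
  Convex ℝ B ∧ ∀ x ∈ interior B, ¬ IsLatticePoint x

/-- A lattice-free convex set that is maximal with respect to inclusion. -/
def IsMaximalLatticeFree (B : Set (Fin 2 → ℝ)) : Prop := Maximal IsLatticeFree B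

/-- The strip `c ≤ a x₁ + b x₂ ≤ c + 1`; it is a split when `a` and `b` are coprime. -/
def split (a b c : ℤ) : Set (Fin 2 → ℝ) :=
  {x | (c : ℝ) ≤ a * x 0 + b * x 1 ∧ (a : ℝ) * x 0 + b * x 1 ≤ c + 1}

/-- A Type 1 triangle: a (nondegenerate) maximal lattice-free triangle with integral vertices and
exactly one integral point in the relative interior of each edge. -/
def IsType1Triangle (T : Set (Fin 2 → ℝ)) : Prop :=
  IsMaximalLatticeFree T ∧
  ∃ v : Fin 3 → (Fin 2 → ℝ), AffineIndependent ℝ v ∧ T = convexHull ℝ (Set.range v) ∧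
    (∀ i, IsLatticePoint (v i)) ∧
    ∀ i j, i ≠ j → ∃! y, y ∈ openSegment ℝ (v i) (v j) ∧ IsLatticePoint y

open Classical in
/-- The function `ψ_B` of a convex set `B` with `f` in its interior: `ψ_B(r) = 1 / t` if `f + t r`
is on the boundary of `B` for some `t > 0`, and `ψ_B(r) = 0` if there is no such `t`
(in particular for `r = 0`). -/
noncomputable def psi (B : Set (Fin 2 → ℝ)) (f r : Fin 2 → ℝ) : ℝ :=
  if h : ∃ t : ℝ, 0 < t ∧ f + t • r ∈ frontier B then 1 / h.choose else 0

/-- `psi` does not depend on the choice of `t`. -/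
theorem psi_eq {B : Set (Fin 2 → ℝ)} (hB : Convex ℝ B) {f : Fin 2 → ℝ} (hf : f ∈ interior B)
    {r : Fin 2 → ℝ} {t : ℝ} (ht : 0 < t) (h : f + t • r ∈ frontier B) : psi B f r = 1 / t := by
  have key : ∀ u : ℝ, 0 < u → f + u • r ∈ frontier B →
      u * gauge ((fun x => f + x) ⁻¹' B) r = 1 := by
    intro u hu hm
    have h1 : Convex ℝ ((fun x => f + x) ⁻¹' B) := hB.translate_preimage_right f
    have h2 : ((fun x => f + x) ⁻¹' B) ∈ nhds (0 : Fin 2 → ℝ) := by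
      apply (continuous_const_add f).continuousAt.preimage_mem_nhds
      simpa using mem_interior_iff_mem_nhds.1 hf
    have h3 : u • r ∈ frontier ((fun x => f + x) ⁻¹' B) := by
      have := (Homeomorph.addLeft f).preimage_frontier B
      rw [show (fun x => f + x) = ⇑(Homeomorph.addLeft f) from rfl, ← this]
      exact hm
    have h4 := (gauge_eq_one_iff_mem_frontier h1 h2).2 h3
    rwa [gauge_smul_of_nonneg hu.le, smul_eq_mul] at h4
  have hex : ∃ t : ℝ, 0 < t ∧ f + t • r ∈ frontier B := ⟨t, ht, h⟩
  have e1 := key t ht h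
  have e2 := key _ hex.choose_spec.1 hex.choose_spec.2
  have hg : gauge ((fun x => f + x) ⁻¹' B) r ≠ 0 := by
    intro h0
    rw [h0] at e1
    simp at e1
  have : hex.choose = t := mul_right_cancel₀ hg (e2.trans e1.symm)
  rw [psi, dif_pos hex, this]

/-- The convex hull `R_f(r¹, …, rᵏ)` of all `s ≥ 0` such that `f + ∑ⱼ sⱼ rʲ` is integral. -/
def integerHull {k : ℕ} (f : Fin 2 → ℝ) (r : Fin k → Fin 2 → ℝ) : Set (Fin k → ℝ) :=
  convexHull ℝ {s | (∀ j, 0 ≤ s j) ∧ IsLatticePoint (f + ∑ j, s j • r j)}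

/-- The inequality `∑ⱼ aⱼ sⱼ ≥ b` defines a facet of `P`: it is valid for `P`, and the points of `P`
satisfying it with equality form a nonempty face of dimension `dim P - 1`. -/
def IsFacetDefining {k : ℕ} (P : Set (Fin k → ℝ)) (a : Fin k → ℝ) (b : ℝ) : Prop :=
  (∀ s ∈ P, b ≤ ∑ j, a j * s j) ∧
  {s | s ∈ P ∧ ∑ j, a j * s j = b}.Nonempty ∧
  Module.finrank ℝ (vectorSpan ℝ {s | s ∈ P ∧ ∑ j, a j * s j = b}) + 1 =
    Module.finrank ℝ (vectorSpan ℝ P)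

/-- The split closure `S_f(r¹, …, rᵏ)`: all `s ≥ 0` that satisfy the inequality `∑ⱼ ψ(rʲ) sⱼ ≥ 1`
of every split with `f` in its interior. -/
def splitClosure {k : ℕ} (f : Fin 2 → ℝ) (r : Fin k → Fin 2 → ℝ) : Set (Fin k → ℝ) :=
  {s | (∀ j, 0 ≤ s j) ∧ ∀ a b c : ℤ, IsCoprime a b → f ∈ interior (split a b c) →
    1 ≤ ∑ j, psi (split a b c) f (r j) * s j}

/-- The functions `ψ` of the Type 1 triangles with `f` in their interior whose inequality
`∑ⱼ ψ(rʲ) sⱼ ≥ 1` defines a facet of `R_f(r¹, …, rᵏ)`. -/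
def type1Facets {k : ℕ} (f : Fin 2 → ℝ) (r : Fin k → Fin 2 → ℝ) : Set ((Fin 2 → ℝ) → ℝ) :=
  {ψ | ∃ T, IsType1Triangle T ∧ f ∈ interior T ∧ ψ = psi T f ∧
    IsFacetDefining (integerHull f r) (fun j => ψ (r j)) 1}

/-- The split closure intersected with all facet inequalities from Type 1 triangles. -/
def splitType1Closure {k : ℕ} (f : Fin 2 → ℝ) (r : Fin k → Fin 2 → ℝ) : Set (Fin k → ℝ) :=
  splitClosure f r ∩ {s | ∀ ψ ∈ type1Facets f r, 1 ≤ ∑ j, ψ (r j) * s j}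

/-- The set `α Q` of the theory of blocking polyhedra: if `Q` is given by inequalities `a x ≥ b`,
then `α Q` is given by the inequalities `α a x ≥ b`; that is, `x ∈ α Q` if and only if the vector
`α x` is in `Q`. (For `α > 0` this is the pointwise multiple of `Q` by `1 / α`.) -/
def relax {k : ℕ} (α : ℝ) (Q : Set (Fin k → ℝ)) : Set (Fin k → ℝ) := {x | α • x ∈ Q}

end LatticeCuts

/-!
Write `λ₀, λ₁, λ₂` for the barycentric coordinates of a Type 1 triangle `T`. The lattice point on
each edge is the midpoint of the edge, and reducing a lattice point modulo the half-edges shows that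
the affine forms `2 λᵢ` are integral on the lattice (otherwise `T` would have a lattice point in its
interior, or a second one on an edge). So `T` is unimodularly equivalent to the triangle with vertices
`(0,0), (2,0), (0,2)`, and each strip `0 ≤ 2 λᵢ ≤ 1` is a split (`exists_split_form`).

Give the `i`-th split the weight `pᵢ = max 0 (1 - 2 λᵢ(f))`. Then `P = ∑ pᵢ ≥ 3 - 2 = 1`, and
`pᵢ > 0` exactly when `f` is in the interior of the split. For a ray `r` put `M = ψ_T(r)`, and let
`Lᵢ` be the linear part of `λᵢ`. Leaving `T` means violating some `λᵢ ≥ 0`, so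
`zᵢ = Lᵢ(r) + λᵢ(f) M ≥ 0`, and `∑ zᵢ = M`. The explicit form of `ψ` for a strip gives
`pᵢ ψᵢ(r) ≤ pᵢ M + zᵢ` (`mul_psi_split_le`), hence `∑ pᵢ ψᵢ(r) ≤ P M + M ≤ 2 P M`. Thus an average
of the split inequalities implies the inequality of `T` up to the factor `2`, for every
Type 1 triangle `T`, whether or not it defines a facet.
-/

namespace LatticeCuts

/-! ### The function `psi` -/

theorem psi_nonneg (B : Set (Fin 2 → ℝ)) (f r : Fin 2 → ℝ) : 0 ≤ psi B f r := by
  unfold psi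
  split_ifs with h
  · exact one_div_nonneg.2 h.choose_spec.1.le
  · exact le_rfl

theorem mem_interior_split {a b c : ℤ} {f : Fin 2 → ℝ} (h0 : (c : ℝ) < a * f 0 + b * f 1)
    (h1 : (a : ℝ) * f 0 + b * f 1 < c + 1) : f ∈ interior (split a b c) := by
  have ho : IsOpen {x : Fin 2 → ℝ | (c : ℝ) < a * x 0 + b * x 1 ∧ (a : ℝ) * x 0 + b * x 1 < c + 1} :=
    IsOpen.and (isOpen_lt (by fun_prop) (by fun_prop)) (isOpen_lt (by fun_prop) (by fun_prop))
  exact interior_maximal (s := split a b c)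
    (fun x (hx : _ ∧ _) => ⟨hx.1.le, hx.2.le⟩) ho ⟨h0, h1⟩

theorem psi_split_le {a b c : ℤ} {f r : Fin 2 → ℝ} {M : ℝ} (hM : 0 ≤ M)
    (h0 : (c : ℝ) < a * f 0 + b * f 1) (h1 : (a : ℝ) * f 0 + b * f 1 < c + 1)
    (hlo : -(a * r 0 + b * r 1) ≤ M * (a * f 0 + b * f 1 - c))
    (hhi : a * r 0 + b * r 1 ≤ M * (c + 1 - (a * f 0 + b * f 1))) :
    psi (split a b c) f r ≤ M := by
  unfold psi
  split_ifs with h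
  · obtain ⟨ht, hfr⟩ := h.choose_spec
    set t := h.choose
    have hs : split a b c =
        (fun x : Fin 2 → ℝ => (a : ℝ) * x 0 + b * x 1) ⁻¹' Set.Icc (c : ℝ) (c + 1) := rfl
    rw [hs] at hfr
    have h2 := (show Continuous fun x : Fin 2 → ℝ => (a : ℝ) * x 0 + b * x 1 by
      fun_prop).frontier_preimage_subset _ hfr
    rw [frontier_Icc (by linarith)] at h2
    simp only [Set.mem_preimage, Pi.add_apply, Pi.smul_apply, smul_eq_mul, Set.mem_insert_iff,
      Set.mem_singleton_iff] at h2
    rw [div_le_iff₀ ht]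
    rcases h2 with h2 | h2
    · have h3 := mul_le_mul_of_nonneg_left hlo ht.le
      have : 0 ≤ (a * f 0 + b * f 1 - c) * (M * t - 1) := by nlinarith
      linarith [nonneg_of_mul_nonneg_right this (by linarith)]
    · have h3 := mul_le_mul_of_nonneg_left hhi ht.le
      have : 0 ≤ (c + 1 - (a * f 0 + b * f 1)) * (M * t - 1) := by nlinarith
      linarith [nonneg_of_mul_nonneg_right this (by linarith)]
  · exact hM

/-- An upper bound for `psi` of a strip, multiplied by the distance `1 - 2 ℓ` from `f` to the far side
of the strip as measured by its linear form. Here `2 ℓ` is the distance from `f` to the near side, `2 l`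
is the value of the form at `r`, and `hz` says that `M` is at least the value of `psi` of the half-plane
bounded by the near side. -/
theorem mul_psi_split_le {a b c : ℤ} {f r : Fin 2 → ℝ} {ℓ l M : ℝ} (hM : 0 ≤ M)
    (hℓ : (a : ℝ) * f 0 + b * f 1 - c = 2 * ℓ) (hl : (a : ℝ) * r 0 + b * r 1 = 2 * l)
    (h0 : 0 < ℓ) (h1 : 2 * ℓ < 1) (hz : 0 ≤ l + ℓ * M) (hz' : l + ℓ * M ≤ M) :
    (1 - 2 * ℓ) * psi (split a b c) f r ≤ (1 - 2 * ℓ) * M + (l + ℓ * M) := by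
  have hp : 0 < 1 - 2 * ℓ := by linarith
  have := psi_split_le (a := a) (b := b) (c := c) (f := f) (r := r)
    (M := M + (l + ℓ * M) / (1 - 2 * ℓ)) (by positivity) (by linarith) (by linarith)
    (by
      have : 0 ≤ (l + ℓ * M) / (1 - 2 * ℓ) * (2 * ℓ) := by positivity
      rw [hℓ, hl]; nlinarith)
    (by
      rw [show (c : ℝ) + 1 - (a * f 0 + b * f 1) = 1 - 2 * ℓ by linarith, hl, add_mul,
        div_mul_cancel₀ _ hp.ne']
      linarith)
  calc (1 - 2 * ℓ) * psi (split a b c) f r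
      ≤ (1 - 2 * ℓ) * (M + (l + ℓ * M) / (1 - 2 * ℓ)) := mul_le_mul_of_nonneg_left this hp.le
    _ = _ := by rw [mul_add, mul_div_cancel₀ _ hp.ne']

/-! ### Barycentric coordinates of a triangle -/

theorem coord_add (b : AffineBasis (Fin 3) ℝ (Fin 2 → ℝ)) (i : Fin 3) (x y : Fin 2 → ℝ) :
    b.coord i (x + y) = b.coord i x + (b.coord i).linear y := by
  rw [add_comm x y]
  simpa [add_comm] using (b.coord i).map_vadd x y

theorem sum_coord_linear (b : AffineBasis (Fin 3) ℝ (Fin 2 → ℝ)) (r : Fin 2 → ℝ) :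
    ∑ i, (b.coord i).linear r = 0 := by
  have h := b.sum_coord_apply_eq_one (0 + r)
  simp only [coord_add, Finset.sum_add_distrib, b.sum_coord_apply_eq_one] at h
  linarith

theorem coord_linear_vertex_sub (b : AffineBasis (Fin 3) ℝ (Fin 2 → ℝ)) (i j l : Fin 3) :
    (b.coord i).linear (b j - b l) = (if i = j then 1 else 0) - (if i = l then 1 else 0) := by
  have h := coord_add b i (b l) (b j - b l)
  rw [add_sub_cancel, b.coord_apply, b.coord_apply] at h
  linarith

/-- The ray from an interior point of a triangle in direction `r` cannot leave the triangle later
than it leaves the half-plane of an edge. -/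
theorem neg_coord_linear_le (b : AffineBasis (Fin 3) ℝ (Fin 2 → ℝ)) {f : Fin 2 → ℝ}
    (hf : f ∈ interior (convexHull ℝ (Set.range b))) (r : Fin 2 → ℝ) (i : Fin 3) :
    0 ≤ (b.coord i).linear r + b.coord i f * psi (convexHull ℝ (Set.range b)) f r := by
  have hpos := hf
  rw [b.interior_convexHull] at hpos
  by_cases hL : 0 ≤ (b.coord i).linear r
  · have := (hpos i).le
    have := psi_nonneg (convexHull ℝ (Set.range b)) f r
    positivity
  have hex : ∃ t : ℝ, 0 < t ∧ f + t • r ∈ frontier (convexHull ℝ (Set.range b)) := by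
    -- At `t = N` the `i`-th coordinate of `f + t r` is `-λᵢ(f) < 0`.
    set N := -2 * b.coord i f / (b.coord i).linear r
    have hN : 0 ≤ N := div_nonneg_of_nonpos (by linarith [hpos i]) (by linarith)
    have hpre : IsPreconnected ((fun t : ℝ => f + t • r) '' Set.Icc 0 N) :=
      isPreconnected_Icc.image _ (by fun_prop)
    have hclosed : IsClosed (convexHull ℝ (Set.range b)) :=
      (Set.finite_range b).isClosed_convexHull ℝ
    have hout : f + N • r ∉ convexHull ℝ (Set.range b) := by
      intro hm
      rw [b.convexHull_eq_nonneg_coord] at hm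
      have h := hm i
      rw [coord_add, map_smul, smul_eq_mul, div_mul_cancel₀ _ (by linarith : _ ≠ _)] at h
      linarith [hpos i]
    by_contra! hno
    -- Otherwise the interior and the complement of the triangle would disconnect the segment.
    obtain ⟨x, -, hx, hx'⟩ := hpre _ _ isOpen_interior hclosed.isOpen_compl (by
        rintro _ ⟨t, ht, rfl⟩
        by_cases hm : f + t • r ∈ convexHull ℝ (Set.range b)
        · left
          by_contra hm'
          have hfr : f + t • r ∈ frontier (convexHull ℝ (Set.range b)) := ⟨subset_closure hm, hm'⟩
          refine hno t (ht.1.lt_of_ne ?_) hfr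
          rintro rfl
          exact hm' (by simpa using hf)
        · exact Or.inr hm)
      ⟨f, ⟨0, ⟨le_rfl, hN⟩, by simp⟩, hf⟩ ⟨f + N • r, ⟨N, ⟨hN, le_rfl⟩, rfl⟩, hout⟩
    exact hx' (interior_subset hx)
  obtain ⟨t, ht, hfr⟩ := hex
  rw [psi_eq (convex_convexHull _ _) hf ht hfr]
  have hcl : f + t • r ∈ convexHull ℝ (Set.range b) :=
    (Set.finite_range b).isClosed_convexHull ℝ |>.frontier_subset hfr
  rw [b.convexHull_eq_nonneg_coord] at hcl
  have h := hcl i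
  rw [coord_add, map_smul, smul_eq_mul] at h
  have : (b.coord i).linear r + b.coord i f * (1 / t)
      = (b.coord i f + t * (b.coord i).linear r) / t := by field_simp; ring
  rw [this]
  positivity

/-! ### Integrality of the barycentric coordinates of a Type 1 triangle -/

theorem IsLatticePoint.add {x y : Fin 2 → ℝ} (hx : IsLatticePoint x) (hy : IsLatticePoint y) :
    IsLatticePoint (x + y) := fun i => by
  obtain ⟨m, hm⟩ := hx i
  obtain ⟨n, hn⟩ := hy i
  exact ⟨m + n, by simp [hm, hn]⟩

theorem IsLatticePoint.zsmul {x : Fin 2 → ℝ} (n : ℤ) (hx : IsLatticePoint x) :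
    IsLatticePoint ((n : ℝ) • x) := fun i => by
  obtain ⟨m, hm⟩ := hx i
  exact ⟨n * m, by simp [hm]⟩

theorem IsLatticePoint.sub {x y : Fin 2 → ℝ} (hx : IsLatticePoint x) (hy : IsLatticePoint y) :
    IsLatticePoint (x - y) := by
  simpa [sub_eq_add_neg] using hx.add (hy.zsmul (-1))

/-- If an edge with integral ends has just one inner lattice point, that point is the midpoint,
because the reflection of the edge in its midpoint preserves the lattice. -/
theorem eq_midpoint_of_existsUnique {x y : Fin 2 → ℝ} (hx : IsLatticePoint x)
    (hy : IsLatticePoint y) (h : ∃! m, m ∈ openSegment ℝ x y ∧ IsLatticePoint m) {m : Fin 2 → ℝ}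
    (hm : m ∈ openSegment ℝ x y) (hml : IsLatticePoint m) : m = (1 / 2 : ℝ) • (x + y) := by
  have hm' : x + y - m ∈ openSegment ℝ x y := by
    obtain ⟨a, b, ha, hb, hab, rfl⟩ := hm
    refine ⟨b, a, hb, ha, by linarith, ?_⟩
    obtain rfl : b = 1 - a := by linarith
    module
  have := h.unique ⟨hm, hml⟩ ⟨hm', (hx.add hy).sub hml⟩
  have h2 : m + m = x + y := by nth_rewrite 1 [this]; abel
  rw [← h2]
  module

theorem exists_sum_fin_three_eq (i : Fin 3) : ∃ j l : Fin 3, i ≠ j ∧ i ≠ l ∧ j ≠ l ∧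
    (∀ x, x = i ∨ x = j ∨ x = l) ∧
    (∀ g : Fin 3 → ℝ, ∑ x, g x = g i + g j + g l) ∧
    ∀ g : Fin 3 → Fin 2 → ℝ, ∑ x, g x = g i + g j + g l := by
  refine ⟨i + 1, i + 2, ?_⟩
  fin_cases i <;> refine ⟨by decide, by decide, by decide, by decide, ?_, ?_⟩ <;> intro g <;>
    simp only [Fin.sum_univ_three, Fin.zero_eta, Fin.mk_one, Fin.reduceFinMk, Fin.reduceAdd,
      zero_add] <;> abel

/-- If `2 λᵢ(p)` were not integral at a lattice point `p`, reducing `p` modulo the half-edges at a vertex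
would give a lattice point in the interior of the triangle, or one on an edge besides the midpoint. -/
theorem exists_int_two_mul_coord {b : AffineBasis (Fin 3) ℝ (Fin 2 → ℝ)}
    (hfree : ∀ x ∈ interior (convexHull ℝ (Set.range b)), ¬ IsLatticePoint x)
    (hv : ∀ i, IsLatticePoint (b i))
    (he : ∀ i j, i ≠ j → ∃! y, y ∈ openSegment ℝ (b i) (b j) ∧ IsLatticePoint y)
    (i : Fin 3) {p : Fin 2 → ℝ} (hp : IsLatticePoint p) : ∃ z : ℤ, 2 * b.coord i p = z := by
  have hhalf : ∀ i j, i ≠ j → IsLatticePoint ((1 / 2 : ℝ) • (b i - b j)) := by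
    intro i j hij
    obtain ⟨m, ⟨hm, hml⟩, -⟩ := he i j hij
    have h := eq_midpoint_of_existsUnique (hv i) (hv j) (he i j hij) hm hml
    have : (1 / 2 : ℝ) • (b i - b j) = m - b j := by rw [h]; module
    rw [this]
    exact hml.sub (hv j)
  obtain ⟨j, l, hij, hil, hjl, hcases, hsum, hsum'⟩ := exists_sum_fin_three_eq i
  -- Reduce `p` modulo the half-edges at the vertex `l`.
  set q := p + (((-⌊2 * b.coord i p⌋ : ℤ) : ℝ) • ((1 / 2 : ℝ) • (b i - b l)) +
    ((-⌊2 * b.coord j p⌋ : ℤ) : ℝ) • ((1 / 2 : ℝ) • (b j - b l))) with hq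
  have hql : IsLatticePoint q := hp.add (((hhalf i l hil).zsmul _).add ((hhalf j l hjl).zsmul _))
  have hqi : 2 * b.coord i q = Int.fract (2 * b.coord i p) := by
    rw [hq, coord_add, map_add, map_smul, map_smul, map_smul, map_smul, coord_linear_vertex_sub,
      coord_linear_vertex_sub, ← Int.self_sub_floor]
    simp only [smul_eq_mul, if_true, if_neg hij, if_neg hil]
    push_cast
    ring
  have hqj : 2 * b.coord j q = Int.fract (2 * b.coord j p) := by
    rw [hq, coord_add, map_add, map_smul, map_smul, map_smul, map_smul, coord_linear_vertex_sub,
      coord_linear_vertex_sub, ← Int.self_sub_floor]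
    simp only [smul_eq_mul, if_true, if_neg hij.symm, if_neg hjl]
    push_cast
    ring
  have hq1 := b.sum_coord_apply_eq_one q
  rw [hsum] at hq1
  have hfi := Int.fract_lt_one (2 * b.coord i p)
  have hfj := Int.fract_lt_one (2 * b.coord j p)
  rcases (Int.fract_nonneg (2 * b.coord i p)).eq_or_lt with h0 | h0
  · exact ⟨⌊2 * b.coord i p⌋, by linarith [Int.self_sub_floor (2 * b.coord i p)]⟩
  exfalso
  rcases (Int.fract_nonneg (2 * b.coord j p)).eq_or_lt with h0' | h0'
  · -- Here `q` is on the edge from `i` to `l`, strictly between `l` and the midpoint.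
    have hj0 : b.coord j q = 0 := by linarith
    have hqe : b.coord i q • b i + b.coord l q • b l = q := by
      have := b.linear_combination_coord_eq_self q
      rw [hsum', hj0, zero_smul, add_zero] at this
      exact this
    have hseg : q ∈ openSegment ℝ (b i) (b l) :=
      ⟨b.coord i q, b.coord l q, by linarith, by linarith, by linarith, hqe⟩
    have hmid := eq_midpoint_of_existsUnique (hv i) (hv l) (he i l hil) hseg hql
    have hmc : b.coord i q = 1 / 2 := by
      have h2 : q = b l + (1 / 2 : ℝ) • (b i - b l) := by rw [hmid]; module
      rw [h2, coord_add, map_smul, coord_linear_vertex_sub, b.coord_apply]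
      simp [hil]
    linarith
  · refine hfree q ?_ hql
    rw [b.interior_convexHull]
    intro x
    rcases hcases x with rfl | rfl | rfl <;> linarith

/-- The form `2 λᵢ` has integral coefficients, and those of its linear part are coprime; thus
`0 ≤ 2 λᵢ ≤ 1` is the split `split m n c`. -/
theorem exists_split_form {b : AffineBasis (Fin 3) ℝ (Fin 2 → ℝ)}
    (hfree : ∀ x ∈ interior (convexHull ℝ (Set.range b)), ¬ IsLatticePoint x)
    (hv : ∀ i, IsLatticePoint (b i))
    (he : ∀ i j, i ≠ j → ∃! y, y ∈ openSegment ℝ (b i) (b j) ∧ IsLatticePoint y) (i : Fin 3) :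
    ∃ m n c : ℤ, IsCoprime m n ∧
      (∀ x : Fin 2 → ℝ, (m : ℝ) * x 0 + n * x 1 - c = 2 * b.coord i x) ∧
      ∀ x : Fin 2 → ℝ, (m : ℝ) * x 0 + n * x 1 = 2 * (b.coord i).linear x := by
  have hint := fun p hp => exists_int_two_mul_coord hfree hv he i (p := p) hp
  have hunit : ∀ s, IsLatticePoint (Pi.single s 1) := fun s t => by
    by_cases h : t = s
    · exact ⟨1, by subst h; simp⟩
    · exact ⟨0, by simp [h]⟩
  have hzero : IsLatticePoint 0 := fun _ => ⟨0, by simp⟩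
  obtain ⟨c, hc⟩ := hint 0 hzero
  have hlin : ∀ s, ∃ m : ℤ, 2 * (b.coord i).linear (Pi.single s 1) = m := by
    intro s
    obtain ⟨m, hm⟩ := hint _ (hunit s)
    refine ⟨m - c, ?_⟩
    have := coord_add b i 0 (Pi.single s 1)
    rw [zero_add] at this
    push_cast
    linarith
  obtain ⟨m, hm⟩ := hlin 0
  obtain ⟨n, hn⟩ := hlin 1
  have hform : ∀ x : Fin 2 → ℝ, (m : ℝ) * x 0 + n * x 1 = 2 * (b.coord i).linear x := by
    intro x
    have hx : x = x 0 • Pi.single 0 1 + x 1 • Pi.single 1 1 := by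
      ext t; fin_cases t <;> simp
    conv_rhs => rw [hx, map_add, map_smul, map_smul, smul_eq_mul, smul_eq_mul]
    rw [← hm, ← hn]
    ring
  refine ⟨m, n, -c, ?_, fun x => ?_, hform⟩
  · -- The form takes the value `1` on the half-edge from another vertex to the vertex `i`.
    obtain ⟨j, l, hij, -⟩ := exists_sum_fin_three_eq i
    obtain ⟨y, ⟨hy, hyl⟩, -⟩ := he i j hij
    have hmid := eq_midpoint_of_existsUnique (hv i) (hv j) (he i j hij) hy hyl
    have hd := hyl.sub (hv j)
    have hval : 2 * (b.coord i).linear (y - b j) = 1 := by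
      rw [show y - b j = (1 / 2 : ℝ) • (b i - b j) by rw [hmid]; module, map_smul,
        coord_linear_vertex_sub]
      simp [hij]
    obtain ⟨u, hu⟩ := hd 0
    obtain ⟨w, hw⟩ := hd 1
    refine ⟨u, w, ?_⟩
    rw [← hform, hu, hw] at hval
    have : m * u + n * w = 1 := by exact_mod_cast hval
    linarith
  · have := coord_add b i 0 x
    rw [zero_add] at this
    rw [hform, this]
    push_cast
    linarith

/-! ### Comparison of a Type 1 triangle with the split closure -/

/-- A Type 1 triangle inequality holds up to the factor `2` on the split closure. -/
theorem one_le_two_mul_sum_psi {k : ℕ} {f : Fin 2 → ℝ} {r : Fin k → Fin 2 → ℝ}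
    {T : Set (Fin 2 → ℝ)} (hT : IsType1Triangle T) (hf : f ∈ interior T) {s : Fin k → ℝ}
    (hs : s ∈ splitClosure f r) : 1 ≤ 2 * ∑ j, psi T f (r j) * s j := by
  obtain ⟨hmax, v, hind, rfl, hv, he⟩ := hT
  have htop : affineSpan ℝ (Set.range v) = ⊤ := by
    rw [hind.affineSpan_eq_top_iff_card_eq_finrank_add_one]
    simp
  let b : AffineBasis (Fin 3) ℝ (Fin 2 → ℝ) := ⟨v, hind, htop⟩
  have hfree : ∀ x ∈ interior (convexHull ℝ (Set.range b)), ¬ IsLatticePoint x := hmax.prop.2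
  have hfb : f ∈ interior (convexHull ℝ (Set.range b)) := hf
  choose m n c hcop hform hlin using exists_split_form (b := b) hfree hv he
  have hpos : ∀ i, 0 < b.coord i f := by
    have := hfb
    rwa [b.interior_convexHull] at this
  set p : Fin 3 → ℝ := fun i => max 0 (1 - 2 * b.coord i f) with hp
  have hp0 : ∀ i, 0 ≤ p i := fun i => le_max_left _ _
  have hP : 1 ≤ ∑ i, p i := by
    have h1 : ∑ i, (1 - 2 * b.coord i f) = 1 := by
      rw [Finset.sum_sub_distrib, ← Finset.mul_sum, b.sum_coord_apply_eq_one]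
      norm_num
    calc (1 : ℝ) = ∑ i, (1 - 2 * b.coord i f) := h1.symm
      _ ≤ ∑ i, p i := Finset.sum_le_sum fun i _ => le_max_right _ _
  have hvalid : ∀ i, p i ≤ p i * ∑ j, psi (split (m i) (n i) (c i)) f (r j) * s j := by
    intro i
    rcases le_or_gt (1 - 2 * b.coord i f) 0 with h | h
    · simp [hp, max_eq_left h]
    · refine le_mul_of_one_le_right (hp0 i) (hs.2 _ _ _ (hcop i) (mem_interior_split ?_ ?_)) <;>
        linarith [hform i f, hpos i]
  have hray : ∀ x : Fin 2 → ℝ, ∑ i, p i * psi (split (m i) (n i) (c i)) f x ≤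
      2 * (∑ i, p i) * psi (convexHull ℝ (Set.range b)) f x := by
    intro x
    have hM := psi_nonneg (convexHull ℝ (Set.range b)) f x
    have hz := neg_coord_linear_le b hfb x
    set M := psi (convexHull ℝ (Set.range b)) f x
    have hzsum : ∑ i, ((b.coord i).linear x + b.coord i f * M) = M := by
      rw [Finset.sum_add_distrib, sum_coord_linear, ← Finset.sum_mul, b.sum_coord_apply_eq_one]
      ring
    have hi : ∀ i, p i * psi (split (m i) (n i) (c i)) f x ≤
        p i * M + ((b.coord i).linear x + b.coord i f * M) := by
      intro i
      rcases le_or_gt (1 - 2 * b.coord i f) 0 with h | h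
      · simpa [hp, max_eq_left h] using hz i
      · have hle := Finset.single_le_sum (fun i _ => hz i) (Finset.mem_univ i)
        rw [hzsum] at hle
        simp only [hp, max_eq_right h.le]
        exact mul_psi_split_le hM (hform i f) (hlin i x) (hpos i) (by linarith) (hz i) hle
    calc ∑ i, p i * psi (split (m i) (n i) (c i)) f x
        ≤ ∑ i, (p i * M + ((b.coord i).linear x + b.coord i f * M)) :=
          Finset.sum_le_sum fun i _ => hi i
      _ = (∑ i, p i) * M + 1 * M := by
          rw [Finset.sum_add_distrib, hzsum, Finset.sum_mul, one_mul]
      _ ≤ (∑ i, p i) * M + (∑ i, p i) * M := by gcongr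
      _ = _ := by ring
  have hfin : (∑ i, p i) * 1 ≤
      (∑ i, p i) * (2 * ∑ j, psi (convexHull ℝ (Set.range b)) f (r j) * s j) := by
    calc (∑ i, p i) * 1
        ≤ ∑ i, p i * ∑ j, psi (split (m i) (n i) (c i)) f (r j) * s j := by
          rw [mul_one]
          exact Finset.sum_le_sum fun i _ => hvalid i
      _ = ∑ j, (∑ i, p i * psi (split (m i) (n i) (c i)) f (r j)) * s j := by
          simp only [Finset.mul_sum, Finset.sum_mul]
          rw [Finset.sum_comm]
          simp only [mul_assoc]
      _ ≤ ∑ j, (2 * (∑ i, p i) * psi (convexHull ℝ (Set.range b)) f (r j)) * s j :=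
          Finset.sum_le_sum fun j _ => mul_le_mul_of_nonneg_right (hray _) (hs.1 j)
      _ = _ := by
          generalize ∑ i, p i = P
          rw [← mul_assoc, Finset.mul_sum]
          exact Finset.sum_congr rfl fun j _ => by ring
  exact le_of_mul_le_mul_left hfin (by linarith)

end LatticeCuts

theorem mainTheorem5 (k : ℕ) (hk : 1 ≤ k) (f : Fin 2 → ℝ)
    (hf : LatticeCuts.IsRationalPoint f) (hfz : ¬ LatticeCuts.IsLatticePoint f)
    (r : Fin k → Fin 2 → ℝ) (hr : ∀ j, LatticeCuts.IsRationalPoint (r j)) (hr0 : ∀ j, r j ≠ 0) :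
    LatticeCuts.splitType1Closure f r ⊆ LatticeCuts.splitClosure f r ∧
      LatticeCuts.splitClosure f r ⊆ LatticeCuts.relax 2 (LatticeCuts.splitType1Closure f r) := by
  have hscale : ∀ (a s : Fin k → ℝ), ∑ j, a j * ((2 : ℝ) • s) j = 2 * ∑ j, a j * s j := by
    intro a s
    rw [Finset.mul_sum]
    exact Finset.sum_congr rfl fun j _ => mul_left_comm _ _ _
  refine ⟨Set.inter_subset_left, fun s hs => ⟨⟨fun j => ?_, fun a b c hab hfi => ?_⟩, ?_⟩⟩
  · exact mul_nonneg zero_le_two (hs.1 j)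
  · rw [hscale]
    linarith [hs.2 a b c hab hfi]
  · rintro ψ ⟨T, hT, hfT, rfl, -⟩
    rw [hscale]
    exact LatticeCuts.one_le_two_mul_sum_psi hT hfT hs
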